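/- Let $M$ be a matrix with non-negative real entries, with rows indexed by a set $R$ and columns by a set $C$. An \emph{EF-protocol} for $M$ is a two-party communication protocol of the following kind. Alice receives a row index $i\in R$ and Bob a column index $j\in C$; each of them has private randomness (Alice's being independent of Bob's) and unlimited computational power. The bits exchanged so far determine whose turn it is, and the player whose turn it is either sends one bit to the other player or outputs a non-negative number, which ends the round; this decision may depend only on that player's own input and private randomness and on the bits exchanged so far. The protocol is given by a finite tree, and for all $(i,j)\in R\times C$ the output $X_{ij}$ must satisfy $\mathbb{E}[X_{ij}]=M_{ij}$. The \emph{complexity} of the protocol is the maximum number of bits exchanged, over all inputs $(i,j)$ and all outcomes of the private randomness. For natural numbers $k,n$ let $N^k_n$ be the $2^n\times 2^n$ matrix with rows and columns indexed by $\{0,1\}^n$ and entries $$N^k_n(a,b)=(a^{\intercal}b-k)(a^{\intercal}b-k-1),\qquad a,b\in\{0,1\}^n .$$ \textbf{Lemma.} For $k\ge 1$, every EF-protocol for $N^k_n$ requires $\Omega(n-k)$ bits to be exchanged. That is, there is an absolute constant $\delta>0$ such that for all natural numbers $k\ge 1$ and $n$, every EF-protocol for $N^k_n$ has complexity at least $\delta\,(n-k)$.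 -/

import Mathlib

open MeasureTheory
open scoped NNReal

universe r c u v

/-- A two-party strategy (protocol tree). Alice knows her input `i : R` and her private randomness
`α : ΩA`; Bob knows his input `j : C` and his private randomness `β : ΩB`; both know the bits
exchanged so far, i.e. the current node of the tree. At a node of a player, that player (using only
its own input and randomness) either outputs a non-negative number, which ends the round, or sends
one bit to the other player, after which the round goes on at the corresponding child.
A leaf is a node at which the player has to output a number. -/
inductive Strategy (R C ΩA ΩB : Type*) [MeasurableSpace ΩA] [MeasurableSpace ΩB]
  | aliceOutputs (f : R → ΩA → ℝ≥0) (hf : ∀ i, Measurable (f i)) : Strategy R C ΩA ΩB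
  | bobOutputs (g : C → ΩB → ℝ≥0) (hg : ∀ j, Measurable (g j)) : Strategy R C ΩA ΩB
  | alice (f : R → ΩA → ℝ≥0 ⊕ Bool) (hf : ∀ i, Measurable (f i))
      (next : Bool → Strategy R C ΩA ΩB) : Strategy R C ΩA ΩB
  | bob (g : C → ΩB → ℝ≥0 ⊕ Bool) (hg : ∀ j, Measurable (g j))
      (next : Bool → Strategy R C ΩA ΩB) : Strategy R C ΩA ΩB

namespace Strategy

variable {R C ΩA ΩB : Type*} [MeasurableSpace ΩA] [MeasurableSpace ΩB]

/-- The number that is output when the inputs are `i`, `j` and the private randomness is `α`, `β`. -/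
def output : Strategy R C ΩA ΩB → R → C → ΩA → ΩB → ℝ≥0
  | aliceOutputs f _, i, _, α, _ => f i α
  | bobOutputs g _, _, j, _, β => g j β
  | alice f _ next, i, j, α, β =>
      match f i α with
      | .inl x => x
      | .inr s => (next s).output i j α β
  | bob g _ next, i, j, α, β =>
      match g j β with
      | .inl x => x
      | .inr s => (next s).output i j α β

/-- The number of bits exchanged (by both players together) when the inputs are `i`, `j` and the
private randomness is `α`, `β`. -/
def bits : Strategy R C ΩA ΩB → R → C → ΩA → ΩB → ℕ
  | aliceOutputs _ _, _, _, _, _ => 0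
  | bobOutputs _ _, _, _, _, _ => 0
  | alice f _ next, i, j, α, β =>
      match f i α with
      | .inl _ => 0
      | .inr s => (next s).bits i j α β + 1
  | bob g _ next, i, j, α, β =>
      match g j β with
      | .inl _ => 0
      | .inr s => (next s).bits i j α β + 1

/-- A strategy is a finite tree, so the number of bits exchanged is bounded. -/
theorem exists_bits_le (t : Strategy R C ΩA ΩB) : ∃ h : ℕ, ∀ i j α β, t.bits i j α β ≤ h := by
  induction t with
  | aliceOutputs f hf => exact ⟨0, fun _ _ _ _ => le_rfl⟩
  | bobOutputs g hg => exact ⟨0, fun _ _ _ _ => le_rfl⟩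
  | alice f hf next ih =>
    choose h hh using ih
    refine ⟨max (h true) (h false) + 1, fun i j α β => ?_⟩
    simp only [bits]
    rcases f i α with x | (_ | _)
    · simp
    · exact Nat.succ_le_succ ((hh false i j α β).trans (le_max_right _ _))
    · exact Nat.succ_le_succ ((hh true i j α β).trans (le_max_left _ _))
  | bob g hg next ih =>
    choose h hh using ih
    refine ⟨max (h true) (h false) + 1, fun i j α β => ?_⟩
    simp only [bits]
    rcases g j β with x | (_ | _)
    · simp
    · exact Nat.succ_le_succ ((hh false i j α β).trans (le_max_right _ _))
    · exact Nat.succ_le_succ ((hh true i j α β).trans (le_max_left _ _))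

end Strategy

/-- An EF-protocol for the matrix `M`: private sources of randomness for Alice and for Bob (arbitrary
probability spaces, independent of each other) and a strategy whose output on inputs `i`, `j` has
expected value `M i j`, for all `i`, `j`. -/
structure EFProtocol {R : Type r} {C : Type c} (M : Matrix R C ℝ) where
  ΩA : Type u
  ΩB : Type v
  [measurableSpaceA : MeasurableSpace ΩA]
  [measurableSpaceB : MeasurableSpace ΩB]
  μA : Measure ΩA
  μB : Measure ΩB
  [isProbA : IsProbabilityMeasure μA]
  [isProbB : IsProbabilityMeasure μB]
  strategy : Strategy R C ΩA ΩB
  integrable_output : ∀ i j,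
    Integrable (fun ω : ΩA × ΩB => (strategy.output i j ω.1 ω.2 : ℝ)) (μA.prod μB)
  expected_output : ∀ i j,
    ∫ ω : ΩA × ΩB, (strategy.output i j ω.1 ω.2 : ℝ) ∂(μA.prod μB) = M i j

namespace EFProtocol

variable {R : Type r} {C : Type c} {M : Matrix R C ℝ}

/-- The set of all possible numbers of bits exchanged, over all inputs and all random choices. -/
def bitCounts (P : EFProtocol.{r, c, u, v} M) : Set ℕ :=
  let _ := P.measurableSpaceA
  let _ := P.measurableSpaceB
  {m | ∃ i j α β, P.strategy.bits i j α β = m}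

/-- The complexity of an EF-protocol: the maximum number of bits exchanged. -/
noncomputable def complexity (P : EFProtocol.{r, c, u, v} M) : ℕ := sSup P.bitCounts

/-- The complexity is a genuine maximum. -/
theorem isGreatest_complexity [Nonempty R] [Nonempty C] (P : EFProtocol.{r, c, u, v} M) :
    IsGreatest P.bitCounts P.complexity := by
  let _ := P.measurableSpaceA
  let _ := P.measurableSpaceB
  have hA := P.isProbA
  have hB := P.isProbB
  obtain ⟨α⟩ := P.μA.nonempty_of_neZero
  obtain ⟨β⟩ := P.μB.nonempty_of_neZero
  obtain ⟨h, hh⟩ := P.strategy.exists_bits_le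
  have hbdd : BddAbove P.bitCounts := by
    refine ⟨h, ?_⟩
    rintro m ⟨i, j, α, β, rfl⟩
    exact hh i j α β
  have hne : P.bitCounts.Nonempty :=
    ⟨_, Classical.arbitrary R, Classical.arbitrary C, α, β, rfl⟩
  exact ⟨Nat.sSup_mem hne hbdd, fun m hm => le_csSup hbdd hm⟩

end EFProtocol

/-- The inner product `aᵀb` of two `0/1` vectors of length `n` (`true` is `1`, `false` is `0`). -/
def zeroOneDot {n : ℕ} (a b : Fin n → Bool) : ℕ := ∑ i, (a i).toNat * (b i).toNat

/-- The `2ⁿ × 2ⁿ` matrix `N^k_n`, with entries `(aᵀb - k)(aᵀb - k - 1)` for `a, b ∈ {0,1}ⁿ`. -/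
def matrixN (k n : ℕ) : Matrix (Fin n → Bool) (Fin n → Bool) ℝ :=
  fun a b => ((zeroOneDot a b : ℝ) - k) * ((zeroOneDot a b : ℝ) - k - 1)

/-!
In a run that exchanges `m` bits, the transcript is one of `2 ^ m`, and the inputs (together with
the private randomness) that produce a given transcript form a combinatorial rectangle. Hence the
runs with positive output form a union of fewer than `2 ^ (c + 1)` rectangles, where `c` is the
complexity, and integrating out the randomness turns them into rectangles whose union is the support
of the matrix: an entry is nonzero iff some rectangle is hit with positive probability.

Setting `k - 1` coordinates to `1` on both sides leaves, on the remaining `n - k + 1` coordinates,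
a matrix with entries `(t - 1) * (t - 2)`, where `t = #(A ∩ B)`. It is positive on disjoint pairs and
vanishes on pairs meeting in one point. There are `3 ^ m` disjoint pairs of subsets of an `m`-set,
but a rectangle without pairs meeting in one point contains at most `2 ^ m` of them
(Kaibel and Weltge), so the support needs at least `(3 / 2) ^ m` rectangles.
-/

open Finset

section RectangleUnion

variable {α β γ δ : Type*} {S T : Set (α × β)} {N N' : ℕ}

/-- `S` is the union of `N` combinatorial rectangles. The rectangles may be empty, so that this is
an upper bound on the number of rectangles needed. -/
def IsRectangleUnion (N : ℕ) (S : Set (α × β)) : Prop :=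
  ∃ (X : Fin N → Set α) (Y : Fin N → Set β), S = ⋃ s, X s ×ˢ Y s

namespace IsRectangleUnion

theorem empty (N : ℕ) : IsRectangleUnion N (∅ : Set (α × β)) :=
  ⟨fun _ => ∅, fun _ => ∅, by simp⟩

theorem prod (X : Set α) (Y : Set β) : IsRectangleUnion 1 (X ×ˢ Y) :=
  ⟨fun _ => X, fun _ => Y, (Set.iUnion_const _).symm⟩

theorem union (hS : IsRectangleUnion N S) (hT : IsRectangleUnion N' T) :
    IsRectangleUnion (N + N') (S ∪ T) := by
  obtain ⟨X, Y, rfl⟩ := hS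
  obtain ⟨X', Y', rfl⟩ := hT
  refine ⟨Fin.append X X', Fin.append Y Y', ?_⟩
  rw [← finSumFinEquiv.surjective.iUnion_comp, Set.iUnion_sum]
  simp

theorem mono (hS : IsRectangleUnion N S) (hN : N ≤ N') : IsRectangleUnion N' S := by
  obtain ⟨d, rfl⟩ := Nat.exists_eq_add_of_le hN
  simpa using hS.union (empty d)

theorem prod_inter (hS : IsRectangleUnion N S) (X : Set α) (Y : Set β) :
    IsRectangleUnion N (X ×ˢ Y ∩ S) := by
  obtain ⟨X', Y', rfl⟩ := hS
  exact ⟨fun s => X ∩ X' s, fun s => Y ∩ Y' s, by simp only [Set.inter_iUnion, Set.prod_inter_prod]⟩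

theorem preimage_prodMap (hS : IsRectangleUnion N S) (f : γ → α) (g : δ → β) :
    IsRectangleUnion N (Prod.map f g ⁻¹' S) := by
  obtain ⟨X, Y, rfl⟩ := hS
  exact ⟨fun s => f ⁻¹' X s, fun s => g ⁻¹' Y s, by
    simp only [Set.preimage_iUnion, Set.preimage_prod_map_prod]⟩

theorem measure_prod_ne_zero [MeasurableSpace γ] [MeasurableSpace δ]
    {S : Set ((α × γ) × (β × δ))} (hS : IsRectangleUnion N S)
    (μ : Measure γ) (ν : Measure δ) [SFinite ν] :
    IsRectangleUnion N
      {q : α × β | (μ.prod ν) {ω | ((q.1, ω.1), (q.2, ω.2)) ∈ S} ≠ 0} := by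
  obtain ⟨X, Y, rfl⟩ := hS
  refine ⟨fun s => {i | μ (Prod.mk i ⁻¹' X s) ≠ 0}, fun s => {j | ν (Prod.mk j ⁻¹' Y s) ≠ 0}, ?_⟩
  ext ⟨i, j⟩
  have hsection : {ω : γ × δ | ((i, ω.1), (j, ω.2)) ∈ ⋃ s, X s ×ˢ Y s} =
      ⋃ s, (Prod.mk i ⁻¹' X s) ×ˢ (Prod.mk j ⁻¹' Y s) := by
    ext; simp
  rw [Set.mem_ofPred_eq, hsection, ne_eq, measure_iUnion_null_iff]
  simp [Measure.prod_prod]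

end IsRectangleUnion

end RectangleUnion

namespace Strategy

variable {R C ΩA ΩB : Type*} [MeasurableSpace ΩA] [MeasurableSpace ΩB]

/-- The runs with a positive output and fewer than `c` exchanged bits. Each player's input is paired
with that player's randomness, so that what a player sends is a function of one component. -/
def positiveRuns (t : Strategy R C ΩA ΩB) (c : ℕ) : Set ((R × ΩA) × (C × ΩB)) :=
  {p | t.bits p.1.1 p.2.1 p.1.2 p.2.2 < c ∧ 0 < t.output p.1.1 p.2.1 p.1.2 p.2.2}

theorem positiveRuns_zero (t : Strategy R C ΩA ΩB) : t.positiveRuns 0 = ∅ := by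
  simp [positiveRuns]

theorem positiveRuns_aliceOutputs_succ (f : R → ΩA → ℝ≥0) (hf : ∀ i, Measurable (f i)) (c : ℕ) :
    (aliceOutputs f hf : Strategy R C ΩA ΩB).positiveRuns (c + 1) =
      {p | 0 < f p.1 p.2} ×ˢ Set.univ := by
  ext
  simp [positiveRuns, bits, output]

theorem positiveRuns_bobOutputs_succ (g : C → ΩB → ℝ≥0) (hg : ∀ j, Measurable (g j)) (c : ℕ) :
    (bobOutputs g hg : Strategy R C ΩA ΩB).positiveRuns (c + 1) =
      Set.univ ×ˢ {p | 0 < g p.1 p.2} := by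
  ext
  simp [positiveRuns, bits, output]

theorem positiveRuns_alice_succ (f : R → ΩA → ℝ≥0 ⊕ Bool) (hf : ∀ i, Measurable (f i))
    (next : Bool → Strategy R C ΩA ΩB) (c : ℕ) :
    (alice f hf next).positiveRuns (c + 1) =
      {p | ∃ x, f p.1 p.2 = .inl x ∧ 0 < x} ×ˢ Set.univ ∪
        ({p | f p.1 p.2 = .inr false} ×ˢ Set.univ ∩ (next false).positiveRuns c ∪
          {p | f p.1 p.2 = .inr true} ×ˢ Set.univ ∩ (next true).positiveRuns c) := by
  ext ⟨⟨i, α⟩, ⟨j, β⟩⟩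
  rcases h : f i α with x | (_ | _) <;> simp [positiveRuns, bits, output, h]

theorem positiveRuns_bob_succ (g : C → ΩB → ℝ≥0 ⊕ Bool) (hg : ∀ j, Measurable (g j))
    (next : Bool → Strategy R C ΩA ΩB) (c : ℕ) :
    (bob g hg next).positiveRuns (c + 1) =
      Set.univ ×ˢ {p | ∃ x, g p.1 p.2 = .inl x ∧ 0 < x} ∪
        (Set.univ ×ˢ {p | g p.1 p.2 = .inr false} ∩ (next false).positiveRuns c ∪
          Set.univ ×ˢ {p | g p.1 p.2 = .inr true} ∩ (next true).positiveRuns c) := by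
  ext ⟨⟨i, α⟩, ⟨j, β⟩⟩
  rcases h : g j β with x | (_ | _) <;> simp [positiveRuns, bits, output, h]

theorem isRectangleUnion_positiveRuns (t : Strategy R C ΩA ΩB) (c : ℕ) :
    IsRectangleUnion (2 ^ c - 1) (t.positiveRuns c) := by
  induction c generalizing t with
  | zero =>
    rw [positiveRuns_zero]
    exact .empty _
  | succ c ih =>
    have hcount : 1 + ((2 ^ c - 1) + (2 ^ c - 1)) = 2 ^ (c + 1) - 1 := by
      have := Nat.one_le_two_pow (n := c)
      omega
    rw [← hcount]
    cases t with
    | aliceOutputs f hf =>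
      rw [positiveRuns_aliceOutputs_succ]
      exact (IsRectangleUnion.prod _ _).mono (Nat.le_add_right _ _)
    | bobOutputs g hg =>
      rw [positiveRuns_bobOutputs_succ]
      exact (IsRectangleUnion.prod _ _).mono (Nat.le_add_right _ _)
    | alice f hf next =>
      rw [positiveRuns_alice_succ]
      exact (IsRectangleUnion.prod _ _).union
        (((ih (next false)).prod_inter _ _).union ((ih (next true)).prod_inter _ _))
    | bob g hg next =>
      rw [positiveRuns_bob_succ]
      exact (IsRectangleUnion.prod _ _).union
        (((ih (next false)).prod_inter _ _).union ((ih (next true)).prod_inter _ _))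

end Strategy

namespace EFProtocol

variable {R : Type r} {C : Type c} {M : Matrix R C ℝ}

attribute [local instance] measurableSpaceA measurableSpaceB isProbB

theorem bits_le_complexity (P : EFProtocol.{r, c, u, v} M) (i : R) (j : C) (α : P.ΩA) (β : P.ΩB) :
    P.strategy.bits i j α β ≤ P.complexity :=
  have : Nonempty R := ⟨i⟩
  have : Nonempty C := ⟨j⟩
  P.isGreatest_complexity.2 ⟨i, j, α, β, rfl⟩

theorem apply_ne_zero_iff (P : EFProtocol.{r, c, u, v} M) (i : R) (j : C) :
    M i j ≠ 0 ↔ (P.μA.prod P.μB) {ω | 0 < P.strategy.output i j ω.1 ω.2} ≠ 0 := by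
  rw [← P.expected_output i j, ne_eq,
    integral_eq_zero_iff_of_nonneg (fun _ => NNReal.coe_nonneg _) (P.integrable_output i j),
    Filter.EventuallyEq, ae_iff]
  simp [pos_iff_ne_zero]

theorem isRectangleUnion_support (P : EFProtocol.{r, c, u, v} M) :
    IsRectangleUnion (2 ^ (P.complexity + 1) - 1) {q : R × C | M q.1 q.2 ≠ 0} := by
  have h := (P.strategy.isRectangleUnion_positiveRuns (P.complexity + 1)).measure_prod_ne_zero
    P.μA P.μB
  simpa only [P.apply_ne_zero_iff, Strategy.positiveRuns, Set.mem_ofPred_eq, Nat.lt_succ_iff,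
    P.bits_le_complexity, true_and] using h

end EFProtocol

section DisjointPairs

variable {α : Type*}

open Classical in
/-- The pairs of disjoint subsets of `U` that belong to `S`. -/
noncomputable def disjointPairs (U : Finset α) (S : Set (Finset α × Finset α)) :
    Finset (Finset α × Finset α) :=
  {p ∈ U.powerset ×ˢ U.powerset | Disjoint p.1 p.2 ∧ p ∈ S}

theorem mem_disjointPairs {U A B : Finset α} {S : Set (Finset α × Finset α)} :
    (A, B) ∈ disjointPairs U S ↔ (A ⊆ U ∧ B ⊆ U) ∧ Disjoint A B ∧ (A, B) ∈ S := by
  simp [disjointPairs]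

theorem card_disjointPairs_insert [DecidableEq α] {U : Finset α} {x : α} (hx : x ∉ U)
    (S : Set (Finset α × Finset α)) :
    #(disjointPairs (insert x U) S) = #(disjointPairs U S) +
      #(disjointPairs U (Prod.map (insert x) id ⁻¹' S)) +
      #(disjointPairs U (Prod.map id (insert x) ⁻¹' S)) := by
  simp only [disjointPairs, card_filter, sum_product, sum_powerset_insert hx, ← sum_add_distrib]
  refine sum_congr rfl fun A hA => sum_congr rfl fun B hB => ?_
  have hxA : x ∉ A := fun h => hx (mem_powerset.1 hA h)
  have hxB : x ∉ B := fun h => hx (mem_powerset.1 hB h)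
  have hleft : Disjoint (insert x A) B ↔ Disjoint A B := by
    rw [disjoint_insert_left, and_iff_right hxB]
  have hright : Disjoint A (insert x B) ↔ Disjoint A B := by
    rw [disjoint_insert_right, and_iff_right hxA]
  have hboth : ¬(Disjoint (insert x A) (insert x B) ∧ (insert x A, insert x B) ∈ S) := fun h =>
    disjoint_left.1 h.1 (mem_insert_self x A) (mem_insert_self x B)
  rw [if_neg hboth, add_zero, add_right_comm]
  refine congrArg₂ (· + ·) (congrArg _ ?_) ?_ <;> congr! 2

theorem card_disjointPairs_univ (U : Finset α) : #(disjointPairs U Set.univ) = 3 ^ #U := by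
  classical
  induction U using Finset.induction_on with
  | empty => simp [disjointPairs, filter_singleton]
  | insert x U hx ih =>
    rw [card_disjointPairs_insert hx, Set.preimage_univ, Set.preimage_univ, ih,
      card_insert_of_notMem hx]
    ring

theorem card_disjointPairs_union_add_card_inter (U : Finset α) (S T : Set (Finset α × Finset α)) :
    #(disjointPairs U (S ∪ T)) + #(disjointPairs U (S ∩ T)) =
      #(disjointPairs U S) + #(disjointPairs U T) := by
  classical
  have hunion : disjointPairs U (S ∪ T) = disjointPairs U S ∪ disjointPairs U T := by
    ext ⟨A, B⟩
    simp only [mem_disjointPairs, mem_union, Set.mem_union, and_or_left]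
  have hinter : disjointPairs U (S ∩ T) = disjointPairs U S ∩ disjointPairs U T := by
    ext ⟨A, B⟩
    simp only [mem_disjointPairs, mem_inter, Set.mem_inter_iff]
    tauto
  rw [hunion, hinter, card_union_add_card_inter]

theorem disjointPairs_mono {U : Finset α} {S T : Set (Finset α × Finset α)} (h : S ⊆ T) :
    disjointPairs U S ⊆ disjointPairs U T := fun ⟨_, _⟩ hAB =>
  have ⟨hU, hd, hS⟩ := mem_disjointPairs.1 hAB
  mem_disjointPairs.2 ⟨hU, hd, h hS⟩

theorem card_disjointPairs_insert_prod_le [DecidableEq α] {U : Finset α} {x : α} (hx : x ∉ U)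
    {X Y : Set (Finset α)}
    (h : ∀ A ⊆ insert x U, ∀ B ⊆ insert x U, A ∈ X → B ∈ Y → #(A ∩ B) ≠ 1) :
    #(disjointPairs (insert x U) (X ×ˢ Y)) ≤
      #(disjointPairs U ((X ∪ insert x ⁻¹' X) ×ˢ Y)) +
        #(disjointPairs U (X ×ˢ (Y ∪ insert x ⁻¹' Y))) := by
  set X' := insert x ⁻¹' X with hX'
  set Y' := insert x ⁻¹' Y with hY'
  have hsplit : #(disjointPairs (insert x U) (X ×ˢ Y)) = #(disjointPairs U (X ×ˢ Y)) +
      #(disjointPairs U (X' ×ˢ Y)) + #(disjointPairs U (X ×ˢ Y')) := by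
    simp only [card_disjointPairs_insert hx, Set.preimage_prod_map_prod, Set.preimage_id, hX', hY']
  have hX : #(disjointPairs U ((X ∪ X') ×ˢ Y)) + #(disjointPairs U ((X ∩ X') ×ˢ Y)) =
      #(disjointPairs U (X ×ˢ Y)) + #(disjointPairs U (X' ×ˢ Y)) := by
    rw [Set.union_prod, Set.inter_prod, card_disjointPairs_union_add_card_inter]
  -- If `A, B` were in both, `insert x A ∈ X` and `insert x B ∈ Y` would meet only in `x`.
  have hdisj : Disjoint (disjointPairs U ((X ∩ X') ×ˢ Y)) (disjointPairs U (X ×ˢ Y')) := by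
    rw [disjoint_left]
    rintro ⟨A, B⟩ hA hB
    obtain ⟨⟨hAU, hBU⟩, hAB, ⟨-, hxA⟩, -⟩ := mem_disjointPairs.1 hA
    obtain ⟨-, -, -, hxB⟩ := mem_disjointPairs.1 hB
    refine h _ (insert_subset_insert x hAU) _ (insert_subset_insert x hBU) hxA hxB ?_
    rw [← insert_inter_distrib, disjoint_iff_inter_eq_empty.1 hAB]
    rfl
  have hY : #(disjointPairs U ((X ∩ X') ×ˢ Y)) + #(disjointPairs U (X ×ˢ Y')) ≤
      #(disjointPairs U (X ×ˢ (Y ∪ Y'))) := by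
    rw [← card_union_of_disjoint hdisj]
    exact card_le_card <| union_subset
      (disjointPairs_mono (Set.prod_mono Set.inter_subset_left Set.subset_union_left))
      (disjointPairs_mono (Set.prod_mono_right Set.subset_union_right))
  omega

theorem card_disjointPairs_prod_le [DecidableEq α] {U : Finset α} {X Y : Set (Finset α)}
    (h : ∀ A ⊆ U, ∀ B ⊆ U, A ∈ X → B ∈ Y → #(A ∩ B) ≠ 1) :
    #(disjointPairs U (X ×ˢ Y)) ≤ 2 ^ #U := by
  induction U using Finset.induction_on generalizing X Y with
  | empty =>
    simpa using (card_le_card (disjointPairs_mono (Set.subset_univ _))).trans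
      (card_disjointPairs_univ ∅).le
  | insert x U hx ih =>
    have hsub {A : Finset α} (hA : A ⊆ U) : A ⊆ insert x U := hA.trans (subset_insert x U)
    rw [card_insert_of_notMem hx, pow_succ, mul_two]
    refine (card_disjointPairs_insert_prod_le hx h).trans (add_le_add (ih ?_) (ih ?_)) <;>
      intro A hA B hB hAX hBY
    · rcases hAX with hAX | hAX
      · exact h A (hsub hA) B (hsub hB) hAX hBY
      · rw [← insert_inter_of_notMem fun hxB => hx (hB hxB)]
        exact h _ (insert_subset_insert x hA) B (hsub hB) hAX hBY
    · rcases hBY with hBY | hBY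
      · exact h A (hsub hA) B (hsub hB) hAX hBY
      · rw [← inter_insert_of_notMem fun hxA => hx (hA hxA)]
        exact h A (hsub hA) _ (insert_subset_insert x hB) hAX hBY

theorem IsRectangleUnion.three_pow_card_le_mul [DecidableEq α] {N : ℕ}
    {S : Set (Finset α × Finset α)} {U : Finset α} (hS : IsRectangleUnion N S)
    (hdisj : ∀ A ⊆ U, ∀ B ⊆ U, Disjoint A B → (A, B) ∈ S)
    (hone : ∀ A ⊆ U, ∀ B ⊆ U, #(A ∩ B) = 1 → (A, B) ∉ S) :
    3 ^ #U ≤ N * 2 ^ #U := by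
  obtain ⟨X, Y, rfl⟩ := hS
  calc 3 ^ #U = #(disjointPairs U Set.univ) := (card_disjointPairs_univ U).symm
    _ ≤ #(univ.biUnion fun s => disjointPairs U (X s ×ˢ Y s)) := by
      refine card_le_card fun ⟨A, B⟩ hAB => ?_
      obtain ⟨⟨hA, hB⟩, hd, -⟩ := mem_disjointPairs.1 hAB
      obtain ⟨s, hs⟩ := Set.mem_iUnion.1 (hdisj A hA B hB hd)
      exact mem_biUnion.2 ⟨s, mem_univ s, mem_disjointPairs.2 ⟨⟨hA, hB⟩, hd, hs⟩⟩
    _ ≤ #(univ : Finset (Fin N)) * 2 ^ #U :=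
      card_biUnion_le_card_mul _ _ _ fun s _ => card_disjointPairs_prod_le fun A hA B hB hX hY h =>
        hone A hA B hB h (Set.mem_iUnion.2 ⟨s, hX, hY⟩)
    _ = N * 2 ^ #U := by rw [card_fin]

end DisjointPairs

theorem lt_two_mul_of_three_pow_lt {m d : ℕ} (h : 3 ^ m < 2 ^ d * 2 ^ m) : m < 2 * d := by
  by_contra! hdm
  have hlt : 9 ^ m < 9 ^ m := by
    calc 9 ^ m = 3 ^ m * 3 ^ m := by rw [← mul_pow]; norm_num
      _ < (2 ^ d * 2 ^ m) * (2 ^ d * 2 ^ m) := Nat.mul_self_lt_mul_self h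
      _ = 2 ^ (2 * d) * 2 ^ (2 * m) := by ring
      _ ≤ 2 ^ m * 2 ^ (2 * m) := by gcongr; norm_num
      _ = 8 ^ m := by rw [pow_mul, ← mul_pow]; norm_num
      _ ≤ 9 ^ m := by gcongr; norm_num
  exact lt_irrefl _ hlt

theorem zeroOneDot_decide_mem {n : ℕ} (A B : Finset (Fin n)) :
    zeroOneDot (fun i => decide (i ∈ A)) (fun i => decide (i ∈ B)) = #(A ∩ B) := by
  simp [zeroOneDot, Bool.toNat, Bool.cond_decide, inter_comm]

theorem matrixN_decide_mem_union {n : ℕ} (J : Finset (Fin n)) {A B : Finset (Fin n)}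
    (hA : Disjoint J A) :
    matrixN (#J + 1) n (fun i => decide (i ∈ J ∪ A)) (fun i => decide (i ∈ J ∪ B)) =
      ((#(A ∩ B) : ℝ) - 1) * (#(A ∩ B) - 2) := by
  rw [matrixN, zeroOneDot_decide_mem, ← union_inter_distrib_left,
    card_union_of_disjoint (hA.mono_right inter_subset_left)]
  push_cast
  ring

theorem EFProtocol.le_add_two_mul_complexity_of_matrixN {k n : ℕ} (hk : 1 ≤ k)
    (P : EFProtocol.{0, 0, u, v} (matrixN k n)) : n ≤ k + 2 * P.complexity := by
  rcases lt_or_ge n k with hnk | hkn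
  · omega
  obtain ⟨j, rfl⟩ := Nat.exists_eq_add_of_le' hk
  obtain ⟨J, -, rfl⟩ := exists_subset_card_eq
    (show j ≤ #(univ : Finset (Fin n)) by rw [card_fin]; omega)
  let extend (A : Finset (Fin n)) (i : Fin n) : Bool := decide (i ∈ J ∪ A)
  have hentry {A B : Finset (Fin n)} (hA : A ⊆ Jᶜ) :
      matrixN (#J + 1) n (extend A) (extend B) = ((#(A ∩ B) : ℝ) - 1) * (#(A ∩ B) - 2) :=
    matrixN_decide_mem_union J (disjoint_left.2 fun _ hJ h => mem_compl.1 (hA h) hJ)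
  have hcover : 3 ^ #Jᶜ ≤ (2 ^ (P.complexity + 1) - 1) * 2 ^ #Jᶜ :=
    (P.isRectangleUnion_support.preimage_prodMap extend extend).three_pow_card_le_mul
      (fun A hA B _ hAB => by simp [hentry hA, disjoint_iff_inter_eq_empty.1 hAB])
      (fun A hA B _ hAB => by simp [hentry hA, hAB])
  have hcard : #Jᶜ < 2 * (P.complexity + 1) := lt_two_mul_of_three_pow_lt <|
    hcover.trans_lt (by gcongr; exact Nat.sub_lt (by positivity) one_pos)
  rw [card_compl, Fintype.card_fin] at hcard
  omega

theorem mainTheorem10 :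
    ∃ δ : ℝ, 0 < δ ∧ ∀ k n : ℕ, 1 ≤ k →
      ∀ P : EFProtocol.{0, 0, u, v} (matrixN k n), δ * ((n : ℝ) - (k : ℝ)) ≤ (P.complexity : ℝ) := by
  refine ⟨1 / 2, by norm_num, fun k n hk P => ?_⟩
  have h : (n : ℝ) ≤ k + 2 * P.complexity := by
    exact_mod_cast P.le_add_two_mul_complexity_of_matrixN hk
  linarith
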